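/- Notation. Let $\mathbb R[\mathbf x]=\mathbb R[x_1,\dots,x_n]$, let $\mathbb R[\mathbf x]_d$ be the space of polynomials of degree at most $d$, and let $\mathbb T^n$ (resp. $\mathbb T^n_d$) be the set of monomials (resp. monomials of degree at most $d$). For $S\subseteq\mathbb R[\mathbf x]$ put $S^+=S\cup x_1S\cup\dots\cup x_nS$, and for $\mathcal B\subseteq\mathbb T^n$ put $\partial\mathcal B=\mathcal B^+\setminus\mathcal B$. A set $\mathcal B\subseteq\mathbb T^n$ is connected to $1$ if every $m\in\mathcal B$ can be written $m=m_1m_2\cdots m_k$ with $m_1=1$, $m_2,\dots,m_k\in\{x_1,\dots,x_n\}$ and $m_1\cdots m_h\in\mathcal B$ for $h=1,\dots,k$. For $S\subseteq\mathbb R[\mathbf x]_d$, $S^\perp$ is the space of linear functionals on $\mathbb R[\mathbf x]_d$ vanishing on $S$, and $\pi_s$ denotes restriction of linear functionals to $\mathbb R[\mathbf x]_s$. For an ideal $J$ of $\mathbb R[\mathbf x]$, $\mathcal D[J]$ is the space of linear functionals on $\mathbb R[\mathbf x]$ vanishing on $J$, $V_{\mathbb C}(J)\subseteq\mathbb C^n$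 is its complex variety, $V_{\mathbb R}(J)=V_{\mathbb C}(J)\cap\mathbb R^n$, and its real radical is $\sqrt[\mathbb R]J=\{p\mid p^{2k}+\sum_jq_j^2\in J\text{ for some }k\ge1\text{ and finitely many }q_j\in\mathbb R[\mathbf x]\}$. If $\mathcal B\subseteq\mathbb T^n$, $1\in\mathcal B$, is a basis of $\mathbb R[\mathbf x]/J$, a border basis of $J$ with respect to $\mathcal B$ is a generating set of $J$ of the form $\{m-r_m\mid m\in\partial\mathcal B\}$ with all $r_m\in\mathrm{Span}_{\mathbb R}(\mathcal B)$. Theorem. Let $I=(h_1,\dots,h_r)$ be an ideal of $\mathbb R[\mathbf x]$, $D=\max_j\deg(h_j)$, and let $1\le s\le t$ be integers. Let $\mathcal G\subseteq\mathbb R[\mathbf x]_t$ satisfy $h_1,\dots,h_r\in\mathcal G$ and $\mathcal G\subseteq I$ (resp. $\mathcal G\subseteq\sqrt[\mathbb R]I$). (1) If $\dim\pi_s(\mathcal G^\perp)=0$, then $V_{\mathbb C}(I)=\emptyset$ (resp. $V_{\mathbb R}(I)=\emptyset$). (2) Assume that $s\ge D$ and $$\dim\pi_s(\mathcal G^\perp)=\dim\pi_{s-1}(\mathcal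 G^\perp)=\dim\pi_s((\mathcal G^+)^\perp),$$ where $(\mathcal G^+)^\perp$ is taken in the dual space of $\mathbb R[\mathbf x]_{t+1}$. Then there is a set $\mathcal B\subseteq\mathbb T^n_{s-1}$, closed under taking divisions (and thus connected to $1$), such that $$\mathbb R[\mathbf x]_s=\mathrm{Span}_{\mathbb R}(\mathcal B)\oplus\bigl(\mathbb R[\mathbf x]_s\cap\mathrm{Span}_{\mathbb R}(\mathcal G)\bigr).\qquad(*)$$ (3) Assume in addition to the hypotheses of (2) that $\dim\pi_s(\mathcal G^\perp)\neq0$. Let $\mathcal B\subseteq\mathbb T^n_{s-1}$ be any set connected to $1$ for which $(*)$ holds, let $\varphi$ be the projection of $\mathbb R[\mathbf x]_s$ onto $\mathrm{Span}_{\mathbb R}(\mathcal B)$ along $\mathbb R[\mathbf x]_s\cap\mathrm{Span}_{\mathbb R}(\mathcal G)$, and let $F_0=\{m-\varphi(m)\mid m\in\partial\mathcal B\}$ and $J=(F_0)$. Then $\mathcal B$ is a basis of $\mathbb R[\mathbf x]/J$ and $F_0$ is a border basis of $J$ with respect to $\mathcal B$. Moreover: - If $\mathcal G\subseteq I$, then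 $J=I$. - If $\mathcal G\subseteq\sqrt[\mathbb R]I$, then $V_{\mathbb R}(I)=V_{\mathbb C}(J)\cap\mathbb R^n$, $\;J\cap\mathbb R[\mathbf x]_s=\mathrm{Span}_{\mathbb R}(\mathcal G)\cap\mathbb R[\mathbf x]_s$, $\;\pi_s(\mathcal D[J])=\pi_s(\mathcal G^\perp)$, and in addition $J=\sqrt[\mathbb R]I$ if $\dim\pi_s(\mathcal G^\perp)=|V_{\mathbb R}(I)|$. -/

import Mathlib

open MvPolynomial

noncomputable section

namespace ProlongProj

/-- `ℝ[x]_d`: the polynomials in `n` variables of total degree at most `d`. -/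
abbrev PolyLE (n d : ℕ) : Submodule ℝ (MvPolynomial (Fin n) ℝ) :=
  MvPolynomial.restrictTotalDegree (Fin n) ℝ d

/-- `𝕋ⁿ`: the set of all monomials (with coefficient one). -/
def monomials (n : ℕ) : Set (MvPolynomial (Fin n) ℝ) :=
  {m | ∃ a : Fin n →₀ ℕ, m = monomial a 1}

/-- `𝕋ⁿ_d`: the set of all monomials of degree at most `d`. -/
def monomialsLE (n d : ℕ) : Set (MvPolynomial (Fin n) ℝ) :=
  {m | ∃ a : Fin n →₀ ℕ, a.degree ≤ d ∧ m = monomial a 1}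

/-- The one degree prolongation `S⁺ = S ∪ x₁ S ∪ ⋯ ∪ xₙ S`. -/
def prolongation {n : ℕ} (S : Set (MvPolynomial (Fin n) ℝ)) : Set (MvPolynomial (Fin n) ℝ) :=
  S ∪ ⋃ i : Fin n, (fun p => X i * p) '' S

/-- The border `∂B = B⁺ \ B`. -/
def border {n : ℕ} (B : Set (MvPolynomial (Fin n) ℝ)) : Set (MvPolynomial (Fin n) ℝ) :=
  prolongation B \ B

/-- `B` is closed under taking divisions (by monomials). -/
def DivisionClosed {n : ℕ} (B : Set (MvPolynomial (Fin n) ℝ)) : Prop :=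
  ∀ m ∈ B, ∀ m' ∈ monomials n, m' ∣ m → m' ∈ B

/-- `B` is connected to `1`: every `m ∈ B` can be reached from `1` by multiplying by one variable
at a time, all partial products (the first one being `1`) staying in `B`. -/
def ConnectedToOne {n : ℕ} (B : Set (MvPolynomial (Fin n) ℝ)) : Prop :=
  ∀ m ∈ B, ∃ l : List (Fin n), m = (l.map fun i => X i).prod ∧
    ∀ k ≤ l.length, ((l.take k).map fun i => (X i : MvPolynomial (Fin n) ℝ)).prod ∈ B

/-- The complex variety `V_ℂ(I) ⊆ ℂⁿ`. -/
def complexVariety {n : ℕ} (I : Ideal (MvPolynomial (Fin n) ℝ)) : Set (Fin n → ℂ) :=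
  MvPolynomial.zeroLocus ℂ I

/-- `ℝⁿ` as a subset of `ℂⁿ`. -/
def realPoints (n : ℕ) : Set (Fin n → ℂ) :=
  Set.range fun (v : Fin n → ℝ) (i : Fin n) => (v i : ℂ)

/-- The real variety `V_ℝ(I) = ℝⁿ ∩ V_ℂ(I)`. -/
def realVariety {n : ℕ} (I : Ideal (MvPolynomial (Fin n) ℝ)) : Set (Fin n → ℂ) :=
  realPoints n ∩ complexVariety I

/-- The real radical of `I`: all `p` with `p^(2m) + ∑ⱼ qⱼ² ∈ I` for some `m ≥ 1` and some
finitely many polynomials `qⱼ`. -/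
def realRadical {n : ℕ} (I : Ideal (MvPolynomial (Fin n) ℝ)) : Set (MvPolynomial (Fin n) ℝ) :=
  {p | ∃ (m k : ℕ) (q : Fin k → MvPolynomial (Fin n) ℝ),
    0 < m ∧ p ^ (2 * m) + ∑ j, q j ^ 2 ∈ I}

/-- For `S ⊆ ℝ[x]_d`, the annihilator `S^⊥` in the dual space `(ℝ[x]_d)^*`. -/
def perp {n : ℕ} (d : ℕ) (S : Set (MvPolynomial (Fin n) ℝ)) :
    Submodule ℝ (Module.Dual ℝ (PolyLE n d)) where
  carrier := {L | ∀ p : PolyLE n d, (p : MvPolynomial (Fin n) ℝ) ∈ S → L p = 0}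
  zero_mem' := fun _ _ => rfl
  add_mem' := fun {L M} hL hM p hp => by
    rw [LinearMap.add_apply, hL p hp, hM p hp, add_zero]
  smul_mem' := fun c L hL p hp => by
    rw [LinearMap.smul_apply, hL p hp, smul_zero]

/-- `𝓓[J] = J^⊥`: the linear functionals on `ℝ[x]` vanishing on the ideal `J`. -/
def dualSpace {n : ℕ} (J : Ideal (MvPolynomial (Fin n) ℝ)) :
    Submodule ℝ (Module.Dual ℝ (MvPolynomial (Fin n) ℝ)) where
  carrier := {L | ∀ p ∈ J, L p = 0}
  zero_mem' := fun _ _ => rfl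
  add_mem' := fun {L M} hL hM p hp => by
    rw [LinearMap.add_apply, hL p hp, hM p hp, add_zero]
  smul_mem' := fun c L hL p hp => by
    rw [LinearMap.smul_apply, hL p hp, smul_zero]

theorem polyLE_mono {n s t : ℕ} (h : s ≤ t) : PolyLE n s ≤ PolyLE n t := by
  intro p hp
  rw [MvPolynomial.mem_restrictTotalDegree] at hp ⊢
  exact hp.trans h

/-- The projection `π_s : (ℝ[x]_t)^* → (ℝ[x]_s)^*`, `s ≤ t`, by restriction of functionals. -/
def proj (n : ℕ) {s t : ℕ} (h : s ≤ t) :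
    Module.Dual ℝ (PolyLE n t) →ₗ[ℝ] Module.Dual ℝ (PolyLE n s) :=
  Module.Dual.transpose (Submodule.inclusion (polyLE_mono h))

/-- The projection `π_s : ℝ[x]^* → (ℝ[x]_s)^*` by restriction of functionals. -/
def projFull (n s : ℕ) :
    Module.Dual ℝ (MvPolynomial (Fin n) ℝ) →ₗ[ℝ] Module.Dual ℝ (PolyLE n s) :=
  Module.Dual.transpose (PolyLE n s).subtype

/-- `ℝ[x]_s ∩ Span S`, as a subspace of `ℝ[x]_s`. -/
def spanIn {n : ℕ} (s : ℕ) (S : Set (MvPolynomial (Fin n) ℝ)) : Submodule ℝ (PolyLE n s) :=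
  (Submodule.span ℝ S).comap (PolyLE n s).subtype

/-- The decomposition `ℝ[x]_s = Span B ⊕ (ℝ[x]_s ∩ Span G)`, for `B ⊆ ℝ[x]_s`. -/
def Decomposition {n : ℕ} (s : ℕ) (B G : Set (MvPolynomial (Fin n) ℝ)) : Prop :=
  IsCompl (spanIn s B) (spanIn s G)

/-- The projection `φ` of `ℝ[x]_s` onto `Span B` along `ℝ[x]_s ∩ Span G`. -/
def phi {n s : ℕ} {B G : Set (MvPolynomial (Fin n) ℝ)} (h : Decomposition s B G) :
    PolyLE n s →ₗ[ℝ] PolyLE n s :=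
  Submodule.projection (spanIn s B) (spanIn s G) h

/-- `F₀ = {m - φ(m) | m ∈ ∂B}`; when `B` consists of monomials of degree at most `s - 1`, all of
`∂B` lies in `ℝ[x]_s`, where `φ` is defined. -/
def borderPolys {n s : ℕ} {B G : Set (MvPolynomial (Fin n) ℝ)} (h : Decomposition s B G) :
    Set (MvPolynomial (Fin n) ℝ) :=
  {f | ∃ m : PolyLE n s, (m : MvPolynomial (Fin n) ℝ) ∈ border B ∧ f = (m - phi h m : PolyLE n s)}

/-- `B` is a (linear) basis of `ℝ[x]/J`: the cosets of the elements of `B` are pairwise distinct,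
linearly independent and spanning. -/
def IsBasisMod {n : ℕ} (B : Set (MvPolynomial (Fin n) ℝ))
    (J : Ideal (MvPolynomial (Fin n) ℝ)) : Prop :=
  LinearIndependent ℝ (fun b : B => Ideal.Quotient.mk J (b : MvPolynomial (Fin n) ℝ)) ∧
    Submodule.span ℝ (Set.range fun b : B => Ideal.Quotient.mk J (b : MvPolynomial (Fin n) ℝ)) = ⊤

/-- `F` is a rewriting family (border prebasis) for `B`: it consists of polynomials `m - r_m`, one
for each border monomial `m ∈ ∂B`, with `r_m ∈ Span B`. -/
def IsRewritingFamily {n : ℕ} (B F : Set (MvPolynomial (Fin n) ℝ)) : Prop :=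
  ∃ r : MvPolynomial (Fin n) ℝ → MvPolynomial (Fin n) ℝ,
    (∀ m ∈ border B, r m ∈ Submodule.span ℝ B) ∧ F = (fun m => m - r m) '' border B

/-- `F` is a border basis of the ideal `J`, with respect to the set of monomials `B`. -/
structure IsBorderBasis {n : ℕ} (B F : Set (MvPolynomial (Fin n) ℝ))
    (J : Ideal (MvPolynomial (Fin n) ℝ)) : Prop where
  monomials : B ⊆ monomials n
  one_mem : (1 : MvPolynomial (Fin n) ℝ) ∈ B
  rewriting : IsRewritingFamily B F
  basis : IsBasisMod B J
  generates : Ideal.span F = J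

end ProlongProj

end

/-!
The assumption on dimensions is a *flat extension* condition. Let `K` be the span of `G`. The space
`π_s(G^⊥)` is the annihilator of `K ∩ ℝ[x]_s`, so its dimension is that of the image of `ℝ[x]_s` in
`ℝ[x]/K`. Equality of the first two dimensions then says that every polynomial of degree at most
`s` can be reduced modulo `K` to degree at most `s - 1`
(`exists_sub_mem_of_finrank_truncQuot_eq`), and equality of the first and the third says that the
prolongation of `G` spans no new polynomials of degree at most `s` (`mem_of_finrank_truncQuot_eq`).

The main point is that, under these conditions, `K` agrees in degree at most `s` with an ideal
(`exists_ideal_of_flat`). Composing multiplication by a variable with the reduction gives operators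
that commute, by flatness, and so an action of the polynomial ring; the ideal is the annihilator of
the class of `1`.

For a division-closed complement of `K ∩ ℝ[x]_s`, take the standard monomials for a
degree-compatible order. Flatness makes the leading monomials of `K ∩ ℝ[x]_s` stable under
multiplication as long as the degree stays at most `s`, and reducibility excludes standard monomials
of degree `s`.

For a given `B`, connectedness is needed only to have `1 ∈ B`. Rewriting by the border polynomials
shows that `B` spans modulo the ideal `J` they generate. Since `J` lies in the ideal of the flat
extension argument, which meets the span of `B` trivially, `B` is a basis modulo `J`, and `J` agrees
with `K` in degree at most `s` (`span_borderPolys_disjoint_and_truncation`). This gives `I ≤ J`, and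
`J` lies in `I` or in the real radical of `I` whenever `G` does. In the latter
case one needs that the real radical is an ideal (`realRadicalIdeal`), but no Nullstellensatz: if
`J` has as many real zeros as the dimension of `ℝ[x]/J`, then the evaluations at these zeros, being
linearly independent, span the dual `𝓓[J]`, so `J` contains every polynomial that vanishes at them
(`mem_of_forall_eval_eq_zero`).
-/

noncomputable section

namespace ProlongProj

variable {n : ℕ}

/-! ### Truncated polynomial spaces and the prolongation -/

theorem mem_polyLE {d : ℕ} {p : MvPolynomial (Fin n) ℝ} : p ∈ PolyLE n d ↔ p.totalDegree ≤ d :=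
  mem_restrictTotalDegree _ _ _

theorem monomial_mem_polyLE {d : ℕ} {a : Fin n →₀ ℕ} (c : ℝ) (ha : a.degree ≤ d) :
    monomial a c ∈ PolyLE n d :=
  mem_polyLE.2 ((totalDegree_monomial_le a c).trans ha)

theorem X_mul_mem_polyLE {d : ℕ} (i : Fin n) {p : MvPolynomial (Fin n) ℝ} (hp : p ∈ PolyLE n d) :
    X i * p ∈ PolyLE n (d + 1) := by
  rw [mem_polyLE] at hp ⊢
  refine (totalDegree_mul _ _).trans ?_
  rw [totalDegree_X]
  lia

theorem X_mul_mem_polyLE_of_pred {s : ℕ} (hs : 1 ≤ s) (i : Fin n) {p : MvPolynomial (Fin n) ℝ}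
    (hp : p ∈ PolyLE n (s - 1)) : X i * p ∈ PolyLE n s := by
  have := X_mul_mem_polyLE i hp
  rwa [Nat.sub_add_cancel hs] at this

theorem monomial_eq_smul (a : Fin n →₀ ℕ) (c : ℝ) :
    monomial a c = c • monomial a (1 : ℝ) := by
  simp [smul_monomial]

theorem X_mul_monomial (i : Fin n) (a : Fin n →₀ ℕ) (c : ℝ) :
    X i * monomial a c = monomial (a + Finsupp.single i 1) c := by
  rw [X, monomial_mul, one_mul, add_comm]

theorem degree_add_single (a : Fin n →₀ ℕ) (i : Fin n) :
    (a + Finsupp.single i 1).degree = a.degree + 1 := by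
  simp

/-- Induction on exponent vectors, raising one exponent by one at a time. -/
theorem exponent_induction {P : (Fin n →₀ ℕ) → Prop} (h0 : P 0)
    (hadd : ∀ a i, P a → P (a + Finsupp.single i 1)) (a : Fin n →₀ ℕ) : P a := by
  suffices h : ∀ b, P b → P (b + a) by simpa using h 0 h0
  induction a using Finsupp.induction_linear with
  | zero => simp
  | add f g hf hg => exact fun b hb => add_assoc b f g ▸ hg _ (hf b hb)
  | single i k =>
    induction k with
    | zero => simp
    | succ k ih =>
      intro b hb
      rw [Finsupp.single_add, ← add_assoc]
      exact hadd _ _ (ih b hb)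

theorem polyLE_eq_span (d : ℕ) :
    PolyLE n d = Submodule.span ℝ (monomialsLE n d) := by
  apply le_antisymm
  · intro p hp
    rw [p.as_sum]
    refine Submodule.sum_mem _ fun a ha => ?_
    rw [monomial_eq_smul]
    refine Submodule.smul_mem _ _ (Submodule.subset_span ⟨a, ?_, rfl⟩)
    exact (le_totalDegree ha).trans (mem_polyLE.1 hp)
  · refine Submodule.span_le.2 ?_
    rintro _ ⟨a, ha, rfl⟩
    exact monomial_mem_polyLE 1 ha

theorem span_le_span_prolongation (G : Set (MvPolynomial (Fin n) ℝ)) :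
    Submodule.span ℝ G ≤ Submodule.span ℝ (prolongation G) :=
  Submodule.span_mono Set.subset_union_left

theorem X_mul_mem_span_prolongation (G : Set (MvPolynomial (Fin n) ℝ)) (i : Fin n)
    {p : MvPolynomial (Fin n) ℝ} (hp : p ∈ Submodule.span ℝ G) :
    X i * p ∈ Submodule.span ℝ (prolongation G) := by
  have : Submodule.span ℝ G ≤
      (Submodule.span ℝ (prolongation G)).comap (LinearMap.mulLeft ℝ (X i)) :=
    Submodule.span_le.2 fun g hg => Submodule.subset_span
      (Or.inr (Set.mem_iUnion.2 ⟨i, g, hg, rfl⟩))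
  exact this hp

theorem prolongation_subset_polyLE {G : Set (MvPolynomial (Fin n) ℝ)} {t : ℕ}
    (hG : G ⊆ (PolyLE n t : Set (MvPolynomial (Fin n) ℝ))) :
    prolongation G ⊆ (PolyLE n (t + 1) : Set (MvPolynomial (Fin n) ℝ)) := by
  rintro p (hp | hp)
  · exact polyLE_mono (Nat.le_succ t) (hG hp)
  · obtain ⟨i, q, hq, rfl⟩ := Set.mem_iUnion.1 hp
    exact X_mul_mem_polyLE i (hG hq)

/-! ### Dimensions of projected annihilators -/

/-- The quotient map `ℝ[x] → ℝ[x]/K`, restricted to `ℝ[x]_s`. Its transpose has as range the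
annihilator of `K ∩ ℝ[x]_s` in the dual of `ℝ[x]_s`. -/
def truncQuot (s : ℕ) (K : Submodule ℝ (MvPolynomial (Fin n) ℝ)) :
    PolyLE n s →ₗ[ℝ] MvPolynomial (Fin n) ℝ ⧸ K :=
  K.mkQ ∘ₗ (PolyLE n s).subtype

theorem mem_ker_truncQuot {s : ℕ} {K : Submodule ℝ (MvPolynomial (Fin n) ℝ)} {p : PolyLE n s} :
    p ∈ LinearMap.ker (truncQuot s K) ↔ (p : MvPolynomial (Fin n) ℝ) ∈ K := by
  simp [truncQuot]

theorem range_dualMap_truncQuot {s : ℕ} {K : Submodule ℝ (MvPolynomial (Fin n) ℝ)}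
    {L : Module.Dual ℝ (PolyLE n s)} :
    L ∈ LinearMap.range (truncQuot s K).dualMap ↔
      ∀ p : PolyLE n s, (p : MvPolynomial (Fin n) ℝ) ∈ K → L p = 0 := by
  rw [LinearMap.range_dualMap_eq_dualAnnihilator_ker, Submodule.mem_dualAnnihilator]
  simp only [mem_ker_truncQuot]

theorem map_perp {s t : ℕ} (hst : s ≤ t) {G : Set (MvPolynomial (Fin n) ℝ)}
    (hG : G ⊆ (PolyLE n t : Set (MvPolynomial (Fin n) ℝ))) :
    (perp t G).map (proj n hst) = LinearMap.range (truncQuot s (Submodule.span ℝ G)).dualMap := by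
  apply le_antisymm
  · rintro _ ⟨L, hL, rfl⟩
    rw [range_dualMap_truncQuot]
    intro p hp
    -- a combination of elements of `G` is such a combination already inside `ℝ[x]_t`
    have key : ∀ q ∈ Submodule.span ℝ G, ∀ hq : q ∈ PolyLE n t, L ⟨q, hq⟩ = 0 := by
      intro q hq
      induction hq using Submodule.span_induction with
      | mem x hx => exact fun hq => hL ⟨x, hq⟩ hx
      | zero => exact fun hq => L.map_zero
      | add x y hx hy ihx ihy =>
        intro hq
        have hx' := Submodule.span_le.2 hG hx
        have hy' := Submodule.span_le.2 hG hy
        have : (⟨x + y, hq⟩ : PolyLE n t) = ⟨x, hx'⟩ + ⟨y, hy'⟩ := rfl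
        rw [this, map_add, ihx, ihy, add_zero]
      | smul c x hx ih =>
        intro hq
        have hx' := Submodule.span_le.2 hG hx
        have : (⟨c • x, hq⟩ : PolyLE n t) = c • ⟨x, hx'⟩ := rfl
        rw [this, map_smul, ih, smul_zero]
    exact key p hp (polyLE_mono hst p.2)
  · rintro _ ⟨M, rfl⟩
    refine ⟨(truncQuot t (Submodule.span ℝ G)).dualMap M, fun p hp => ?_, rfl⟩
    have : truncQuot t (Submodule.span ℝ G) p = 0 :=
      mem_ker_truncQuot.2 (Submodule.subset_span hp)
    rw [LinearMap.dualMap_apply, this, map_zero]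

theorem map_dualSpace (s : ℕ) (J : Ideal (MvPolynomial (Fin n) ℝ)) :
    (dualSpace J).map (projFull n s) =
      LinearMap.range (truncQuot s (J.restrictScalars ℝ)).dualMap := by
  apply le_antisymm
  · rintro _ ⟨L, hL, rfl⟩
    rw [range_dualMap_truncQuot]
    exact fun p hp => hL p hp
  · rintro _ ⟨M, rfl⟩
    refine ⟨M ∘ₗ (J.restrictScalars ℝ).mkQ, fun p hp => ?_, rfl⟩
    have : (J.restrictScalars ℝ).mkQ p = 0 := by simpa using hp
    rw [LinearMap.comp_apply, this, map_zero]

theorem finrank_map_perp {s t : ℕ} (hst : s ≤ t) {G : Set (MvPolynomial (Fin n) ℝ)}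
    (hG : G ⊆ (PolyLE n t : Set (MvPolynomial (Fin n) ℝ))) :
    Module.finrank ℝ ((perp t G).map (proj n hst)) =
      Module.finrank ℝ (LinearMap.range (truncQuot s (Submodule.span ℝ G))) := by
  rw [map_perp hst hG, LinearMap.finrank_range_dualMap_eq_finrank_range]

theorem mem_of_finrank_truncQuot_eq_zero {s : ℕ} {K : Submodule ℝ (MvPolynomial (Fin n) ℝ)}
    (h : Module.finrank ℝ (LinearMap.range (truncQuot s K)) = 0)
    {p : MvPolynomial (Fin n) ℝ} (hp : p ∈ PolyLE n s) : p ∈ K := by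
  have h0 := Submodule.finrank_eq_zero.1 h
  have : truncQuot s K ⟨p, hp⟩ = 0 := by
    rw [← Submodule.mem_bot (R := ℝ), ← h0]
    exact LinearMap.mem_range_self _ _
  exact mem_ker_truncQuot.1 this

/-- If passing from `K` to `K'` does not lower the dimension of the image of `ℝ[x]_s`, then `K'`
contains no new polynomials of degree at most `s`. -/
theorem mem_of_finrank_truncQuot_eq {s : ℕ} {K K' : Submodule ℝ (MvPolynomial (Fin n) ℝ)}
    (hKK' : K ≤ K')
    (h : Module.finrank ℝ (LinearMap.range (truncQuot s K)) =
      Module.finrank ℝ (LinearMap.range (truncQuot s K')))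
    {p : MvPolynomial (Fin n) ℝ} (hp : p ∈ PolyLE n s) (hpK : p ∈ K') : p ∈ K := by
  have h1 := (truncQuot s K).finrank_range_add_finrank_ker
  have h2 := (truncQuot s K').finrank_range_add_finrank_ker
  have hle : LinearMap.ker (truncQuot s K) ≤ LinearMap.ker (truncQuot s K') := fun q hq =>
    mem_ker_truncQuot.2 (hKK' (mem_ker_truncQuot.1 hq))
  have heq := Submodule.eq_of_le_of_finrank_eq hle (by lia)
  have : (⟨p, hp⟩ : PolyLE n s) ∈ LinearMap.ker (truncQuot s K) :=
    heq ▸ mem_ker_truncQuot.2 hpK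
  exact mem_ker_truncQuot.1 this

/-- If `ℝ[x]_r` and `ℝ[x]_s`, `r ≤ s`, have images of the same dimension in `ℝ[x]/K`, then every
polynomial of degree at most `s` can be reduced modulo `K` to degree at most `r`. -/
theorem exists_sub_mem_of_finrank_truncQuot_eq {r s : ℕ} (hrs : r ≤ s)
    {K : Submodule ℝ (MvPolynomial (Fin n) ℝ)}
    (h : Module.finrank ℝ (LinearMap.range (truncQuot s K)) =
      Module.finrank ℝ (LinearMap.range (truncQuot r K)))
    {p : MvPolynomial (Fin n) ℝ} (hp : p ∈ PolyLE n s) : ∃ q ∈ PolyLE n r, p - q ∈ K := by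
  have hle : LinearMap.range (truncQuot r K) ≤ LinearMap.range (truncQuot s K) := by
    rintro _ ⟨q, rfl⟩
    exact ⟨⟨q, polyLE_mono hrs q.2⟩, rfl⟩
  have heq := Submodule.eq_of_le_of_finrank_eq hle h.symm
  have : truncQuot s K ⟨p, hp⟩ ∈ LinearMap.range (truncQuot r K) :=
    heq ▸ LinearMap.mem_range_self _ _
  obtain ⟨q, hq⟩ := this
  exact ⟨q, q.2, (Submodule.Quotient.eq K).1 hq.symm⟩

/-! ### Flat extension: the multiplication operators -/

/-- Evaluation of polynomials at commuting operators. Since `MvPolynomial.aeval` needs a commutative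
target, it is taken in the subalgebra generated by the operators. -/
theorem exists_algHom_of_commute {V : Type*} [AddCommGroup V] [Module ℝ V]
    (M : Fin n → Module.End ℝ V) (hM : ∀ i j, M i * M j = M j * M i) :
    ∃ T : MvPolynomial (Fin n) ℝ →ₐ[ℝ] Module.End ℝ V, ∀ i, T (X i) = M i := by
  have hc := Algebra.isMulCommutative_adjoin ℝ (s := Set.range M) (by
    rintro _ ⟨i, rfl⟩ _ ⟨j, rfl⟩
    exact hM i j)
  let A := Algebra.adjoin ℝ (Set.range M)
  let _ : CommRing A := { (inferInstance : Ring A) with mul_comm := fun a b => hc.is_comm.comm a b }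
  let f : Fin n → A := fun i => ⟨M i, Algebra.subset_adjoin ⟨i, rfl⟩⟩
  exact ⟨A.val.comp (aeval f), fun i => by simp [f]⟩

/-- **Flat extension.** Let `xᵢ K ≤ K'` for all `i`, and suppose that all elements of `K'` of degree
at most `s` lie in `K`. If some `Φ` reduces all polynomials of degree at most
`s` to degree at most `s - 1` modulo `K`, then `K` agrees in degree at most `s` with an ideal.

The maps `v ↦ Φ (xᵢ Φ v)` commute, because `xⱼ Φ (xᵢ p)` and `xᵢ Φ (xⱼ p)` differ by an element of
`K'` of degree at most `s`. The ideal consists of the polynomials in these operators that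
annihilate `Φ 1`. -/
theorem exists_ideal_of_flat {s : ℕ} (hs : 1 ≤ s) {K K' : Submodule ℝ (MvPolynomial (Fin n) ℝ)}
    (hX : ∀ i, ∀ p ∈ K, X i * p ∈ K') (hflat : ∀ p ∈ PolyLE n s, p ∈ K' → p ∈ K)
    (Φ : MvPolynomial (Fin n) ℝ →ₗ[ℝ] MvPolynomial (Fin n) ℝ)
    (hΦ : ∀ p, Φ p ∈ PolyLE n (s - 1)) (hsub : ∀ p ∈ PolyLE n s, p - Φ p ∈ K)
    (hker : ∀ p ∈ PolyLE n s, p ∈ K → Φ p = 0) :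
    ∃ A : Ideal (MvPolynomial (Fin n) ℝ), ∀ p ∈ PolyLE n s, p ∈ A ↔ p ∈ K := by
  have hle : PolyLE n (s - 1) ≤ PolyLE n s := polyLE_mono (Nat.sub_le s 1)
  have hΦs : ∀ p, Φ p ∈ PolyLE n s := fun p => hle (hΦ p)
  have hXΦ : ∀ i p, X i * Φ p ∈ PolyLE n s := fun i p => X_mul_mem_polyLE_of_pred hs i (hΦ p)
  have hcongr : ∀ p q, p - q ∈ PolyLE n s → p - q ∈ K' → Φ p = Φ q := fun p q h h' => by
    rw [← sub_eq_zero, ← map_sub]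
    exact hker _ h (hflat _ h h')
  have hidem : ∀ p ∈ PolyLE n s, Φ (Φ p) = Φ p := fun p hp => by
    rw [eq_comm, ← sub_eq_zero, ← map_sub]
    exact hker _ (sub_mem hp (hΦs p)) (hsub p hp)
  let M : Fin n → Module.End ℝ (MvPolynomial (Fin n) ℝ) := fun i =>
    Φ ∘ₗ LinearMap.mulLeft ℝ (X i) ∘ₗ Φ
  have hMa : ∀ i v, M i v = Φ (X i * Φ v) := fun i v => rfl
  have hM : ∀ i j, M i * M j = M j * M i := by
    intro i j
    refine LinearMap.ext fun v => ?_
    simp only [Module.End.mul_apply, hMa]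
    rw [hidem _ (hXΦ j v), hidem _ (hXΦ i v)]
    refine hcongr _ _ (sub_mem (hXΦ _ _) (hXΦ _ _)) ?_
    have h1 := hX i _ (hsub _ (hXΦ j v))
    have h2 := hX j _ (hsub _ (hXΦ i v))
    convert sub_mem h2 h1 using 1
    ring
  obtain ⟨T, hT⟩ := exists_algHom_of_commute M hM
  have hψ : ∀ p ∈ PolyLE n s, T p (Φ 1) = Φ p := by
    have hmon : ∀ a : Fin n →₀ ℕ, a.degree ≤ s → T (monomial a 1) (Φ 1) = Φ (monomial a 1) := by
      intro a
      induction a using exponent_induction with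
      | h0 => simp
      | hadd a i ih =>
        intro ha
        rw [degree_add_single] at ha
        have hm : monomial a (1 : ℝ) ∈ PolyLE n (s - 1) := monomial_mem_polyLE 1 (by lia)
        rw [← X_mul_monomial, map_mul, Module.End.mul_apply, ih (by lia), hT, hMa,
          hidem _ (hle hm)]
        refine (hcongr _ _ ?_ ?_).symm
        · exact sub_mem (X_mul_mem_polyLE_of_pred hs i hm) (hXΦ i _)
        · rw [← mul_sub]
          exact hX i _ (hsub _ (hle hm))
    intro p hp
    rw [polyLE_eq_span] at hp
    induction hp using Submodule.span_induction with
    | mem x hx =>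
      obtain ⟨a, ha, rfl⟩ := hx
      exact hmon a ha
    | zero => simp
    | add x y _ _ ihx ihy => rw [map_add, LinearMap.add_apply, ihx, ihy, map_add]
    | smul c x _ ih => rw [map_smul, LinearMap.smul_apply, ih, map_smul]
  refine ⟨{ carrier := {p | T p (Φ 1) = 0}
            zero_mem' := by simp
            add_mem' := fun {p q} hp hq => ?_
            smul_mem' := fun c p hp => ?_ }, fun p hp => ?_⟩
  · simp only [Set.mem_ofPred_eq] at hp hq ⊢
    rw [map_add, LinearMap.add_apply, hp, hq, add_zero]
  · simp only [Set.mem_ofPred_eq, smul_eq_mul] at hp ⊢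
    rw [map_mul, Module.End.mul_apply, hp, map_zero]
  · change T p (Φ 1) = 0 ↔ p ∈ K
    rw [hψ p hp]
    refine ⟨fun h => ?_, hker p hp⟩
    have := hsub p hp
    rwa [h, sub_zero] at this

/-! ### Sets of monomials connected to one -/

theorem ConnectedToOne.one_mem {B : Set (MvPolynomial (Fin n) ℝ)} (hB : ConnectedToOne B)
    (hne : B.Nonempty) : (1 : MvPolynomial (Fin n) ℝ) ∈ B := by
  obtain ⟨m, hm⟩ := hne
  obtain ⟨l, -, hl⟩ := hB m hm
  simpa using hl 0 (Nat.zero_le _)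

theorem exists_list_prod_eq_monomial (a : Fin n →₀ ℕ) :
    ∃ l : List (Fin n), (l.map fun i => (X i : MvPolynomial (Fin n) ℝ)).prod = monomial a 1 := by
  induction a using exponent_induction with
  | h0 => exact ⟨[], by simp⟩
  | hadd a i ih =>
    obtain ⟨l, hl⟩ := ih
    exact ⟨i :: l, by rw [List.map_cons, List.prod_cons, hl, X_mul_monomial]⟩

theorem list_prod_mem_monomials (l : List (Fin n)) :
    (l.map fun i => (X i : MvPolynomial (Fin n) ℝ)).prod ∈ monomials n := by
  induction l with
  | nil => exact ⟨0, by simp⟩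
  | cons i l ih =>
    obtain ⟨a, ha⟩ := ih
    exact ⟨a + Finsupp.single i 1, by rw [List.map_cons, List.prod_cons, ha, X_mul_monomial]⟩

theorem DivisionClosed.connectedToOne {B : Set (MvPolynomial (Fin n) ℝ)} (hB : DivisionClosed B)
    (hmon : B ⊆ monomials n) : ConnectedToOne B := by
  intro m hm
  obtain ⟨a, rfl⟩ := hmon hm
  obtain ⟨l, hl⟩ := exists_list_prod_eq_monomial a
  refine ⟨l, hl.symm, fun k _ => hB _ hm _ (list_prod_mem_monomials _) ?_⟩
  rw [← hl]
  refine ⟨((l.drop k).map fun i => X i).prod, ?_⟩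
  rw [← List.prod_append, ← List.map_append, List.take_append_drop]

theorem monomialsLE_subset_monomials (n d : ℕ) : monomialsLE n d ⊆ monomials n := by
  rintro _ ⟨a, -, rfl⟩
  exact ⟨a, rfl⟩

theorem monomialsLE_subset_polyLE (n d : ℕ) :
    monomialsLE n d ⊆ (PolyLE n d : Set (MvPolynomial (Fin n) ℝ)) := by
  rintro _ ⟨a, ha, rfl⟩
  exact monomial_mem_polyLE 1 ha

/-! ### A complement spanned by standard monomials -/

section Standard

variable {s : ℕ} {K K' : Submodule ℝ (MvPolynomial (Fin n) ℝ)}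

/-- The standard monomials of `K ∩ ℝ[x]_s`: those monomials of degree at most `s` that are not
leading monomials of a nonzero element of `K ∩ ℝ[x]_s`. The leading monomials are taken for the
degree lexicographic order, so that reduction does not raise the degree. -/
def standardMonomials (s : ℕ) (K : Submodule ℝ (MvPolynomial (Fin n) ℝ)) :
    Set (MvPolynomial (Fin n) ℝ) :=
  {m | ∃ a : Fin n →₀ ℕ, a.degree ≤ s ∧
    (∀ f ∈ K, f ∈ PolyLE n s → f ≠ 0 → MonomialOrder.degLex.degree f ≠ a) ∧ m = monomial a 1}

theorem monomial_mul_mem_of_flat (hX : ∀ i, ∀ p ∈ K, X i * p ∈ K')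
    (hflat : ∀ p ∈ PolyLE n s, p ∈ K' → p ∈ K) {f : MvPolynomial (Fin n) ℝ} (hf : f ∈ K)
    (c : Fin n →₀ ℕ) (hc : f.totalDegree + c.degree ≤ s) : monomial c 1 * f ∈ K := by
  induction c using exponent_induction with
  | h0 => simpa using hf
  | hadd c i ih =>
    rw [degree_add_single] at hc
    rw [← X_mul_monomial, mul_assoc]
    refine hflat _ ?_ (hX i _ (ih (by lia)))
    rw [← mul_assoc, X_mul_monomial, mem_polyLE]
    refine (totalDegree_mul _ _).trans ?_
    have := totalDegree_monomial_le (c + Finsupp.single i 1) (1 : ℝ)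
    change _ ≤ (c + Finsupp.single i 1).degree at this
    rw [degree_add_single] at this
    lia

theorem standardMonomials_divisionClosed (hX : ∀ i, ∀ p ∈ K, X i * p ∈ K')
    (hflat : ∀ p ∈ PolyLE n s, p ∈ K' → p ∈ K) : DivisionClosed (standardMonomials s K) := by
  rintro _ ⟨a, has, ha, rfl⟩ _ ⟨b, rfl⟩ hdvd
  have hba : b ≤ a := (monomial_dvd_monomial.1 hdvd).1.resolve_left one_ne_zero
  obtain ⟨c, rfl⟩ := exists_add_of_le hba
  rw [map_add] at has
  refine ⟨b, by lia, ?_, rfl⟩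
  rintro f hfK hfs hf0 rfl
  have hdeg : f.totalDegree + c.degree ≤ s := by rwa [← degree_degLexDegree]
  have hmul := monomial_mul_mem_of_flat hX hflat hfK c hdeg
  have hc0 : monomial c (1 : ℝ) ≠ 0 := by simp
  refine ha _ hmul ?_ (mul_ne_zero hc0 hf0) ?_
  · rw [mem_polyLE]
    have := totalDegree_mul (monomial c (1 : ℝ)) f
    have h2 : (monomial c (1 : ℝ)).totalDegree ≤ c.degree := totalDegree_monomial_le c (1 : ℝ)
    lia
  · classical
    rw [MonomialOrder.degree_mul hc0 hf0, MonomialOrder.degree_monomial, if_neg one_ne_zero,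
      add_comm]

theorem standardMonomials_subset_monomialsLE
    (hred : ∀ p ∈ PolyLE n s, ∃ q ∈ PolyLE n (s - 1), p - q ∈ K) :
    standardMonomials s K ⊆ monomialsLE n (s - 1) := by
  rintro _ ⟨a, has, ha, rfl⟩
  refine ⟨a, ?_, rfl⟩
  by_contra! hlt
  have ham := monomial_mem_polyLE 1 has
  obtain ⟨q, hq, hqK⟩ := hred _ ham
  have hqs := polyLE_mono (Nat.sub_le s 1) hq
  -- the leading monomial of `xᵃ - q` is `xᵃ`, as `q` has smaller degree
  have hlt' : MonomialOrder.degLex.toSyn (MonomialOrder.degLex.degree q) <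
      MonomialOrder.degLex.toSyn (MonomialOrder.degLex.degree (monomial a (1 : ℝ))) := by
    classical
    rw [MonomialOrder.degree_monomial, if_neg one_ne_zero, MonomialOrder.degLex_lt_iff,
      Finsupp.DegLex.lt_iff]
    left
    change (MonomialOrder.degLex.degree q).degree < a.degree
    rw [degree_degLexDegree]
    exact lt_of_le_of_lt (mem_polyLE.1 hq) hlt
  have hdeg : MonomialOrder.degLex.degree (monomial a (1 : ℝ) - q) = a := by
    classical
    rw [MonomialOrder.degree_sub_of_lt hlt', MonomialOrder.degree_monomial, if_neg one_ne_zero]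
  refine ha _ hqK (sub_mem ham hqs) ?_ hdeg
  intro h0
  rw [sub_eq_zero] at h0
  rw [h0] at hlt'
  exact lt_irrefl _ hlt'

theorem standardMonomials_subset_polyLE :
    standardMonomials s K ⊆ (PolyLE n s : Set (MvPolynomial (Fin n) ℝ)) := by
  rintro _ ⟨a, has, -, rfl⟩
  exact monomial_mem_polyLE 1 has

theorem eq_zero_of_mem_span_standardMonomials {p : MvPolynomial (Fin n) ℝ}
    (hp : p ∈ Submodule.span ℝ (standardMonomials s K)) (hpK : p ∈ K) : p = 0 := by
  by_contra hp0
  have hps : p ∈ PolyLE n s := Submodule.span_le.2 standardMonomials_subset_polyLE hp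
  have hcoeff : coeff (MonomialOrder.degLex.degree p) p = 0 := by
    have hlead := fun a (ha : ∀ f ∈ K, f ∈ PolyLE n s → f ≠ 0 →
      MonomialOrder.degLex.degree f ≠ a) => ha p hpK hps hp0
    generalize MonomialOrder.degLex.degree p = d at hlead
    clear hps hp0 hpK
    induction hp using Submodule.span_induction with
    | mem x hx =>
      classical
      obtain ⟨a, -, ha, rfl⟩ := hx
      rw [coeff_monomial, if_neg (hlead a ha).symm]
    | zero => simp
    | add x y _ _ ihx ihy => rw [coeff_add, ihx, ihy, add_zero]
    | smul c x _ ih => rw [coeff_smul, ih, smul_zero]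
  exact MonomialOrder.coeff_degree_ne_zero_iff.2 hp0 hcoeff

theorem monomial_mem_span_standardMonomials_sup (a : Fin n →₀ ℕ) (ha : a.degree ≤ s) :
    monomial a (1 : ℝ) ∈ Submodule.span ℝ (standardMonomials s K) ⊔ K := by
  induction hα : MonomialOrder.degLex.toSyn a using WellFoundedLT.induction generalizing a with
  | ind α ih =>
    subst hα
    by_cases hE : ∀ f ∈ K, f ∈ PolyLE n s → f ≠ 0 → MonomialOrder.degLex.degree f ≠ a
    · exact Submodule.mem_sup_left (Submodule.subset_span ⟨a, ha, hE, rfl⟩)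
    · push Not at hE
      obtain ⟨f, hfK, hfs, hf0, rfl⟩ := hE
      set d := MonomialOrder.degLex.degree f with hd
      have hlc : coeff d f ≠ 0 := MonomialOrder.coeff_degree_ne_zero_iff.2 hf0
      have hdsupp : d ∈ f.support := mem_support_iff.2 hlc
      -- `f` expresses its leading monomial by smaller ones modulo `K`
      have hsum : coeff d f • monomial d (1 : ℝ) =
          f - ∑ b ∈ f.support.erase d, monomial b (coeff b f) := by
        rw [← monomial_eq_smul, eq_sub_iff_add_eq, Finset.add_sum_erase _
          (fun b => monomial b (coeff b f)) hdsupp, support_sum_monomial_coeff]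
      rw [← Submodule.smul_mem_iff _ hlc, hsum]
      refine sub_mem (Submodule.mem_sup_right hfK) (Submodule.sum_mem _ fun b hb => ?_)
      rw [monomial_eq_smul]
      obtain ⟨hbd, hbs⟩ := Finset.mem_erase.1 hb
      refine Submodule.smul_mem _ _ (ih _ ?_ b ?_ rfl)
      · exact lt_of_le_of_ne (MonomialOrder.le_degree hbs) fun h =>
          hbd (MonomialOrder.degLex.toSyn.injective h)
      · exact (le_totalDegree hbs).trans (mem_polyLE.1 hfs)

theorem decomposition_standardMonomials {G : Set (MvPolynomial (Fin n) ℝ)} :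
    Decomposition s (standardMonomials s (Submodule.span ℝ G)) G := by
  constructor
  · rw [Submodule.disjoint_def]
    intro p hpB hpG
    exact Subtype.ext (eq_zero_of_mem_span_standardMonomials hpB hpG)
  · rw [codisjoint_iff, eq_top_iff]
    rintro ⟨p, hp⟩ -
    have hp' : p ∈ Submodule.span ℝ (standardMonomials s (Submodule.span ℝ G)) ⊔
        Submodule.span ℝ G := by
      have hle : PolyLE n s ≤ Submodule.span ℝ (standardMonomials s (Submodule.span ℝ G)) ⊔
          Submodule.span ℝ G := by
        rw [polyLE_eq_span, Submodule.span_le]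
        rintro _ ⟨a, ha, rfl⟩
        exact monomial_mem_span_standardMonomials_sup a ha
      exact hle hp
    obtain ⟨b, hb, g, hg, rfl⟩ := Submodule.mem_sup.1 hp'
    have hbs : b ∈ PolyLE n s := Submodule.span_le.2 standardMonomials_subset_polyLE hb
    have hgs : g ∈ PolyLE n s := by simpa using sub_mem hp hbs
    exact Submodule.mem_sup.2 ⟨⟨b, hbs⟩, hb, ⟨g, hgs⟩, hg, rfl⟩

end Standard

/-! ### The real radical -/

theorem exists_sum_sq_of_isSumSq {R : Type*} [CommRing R] {σ : R} (h : IsSumSq σ) :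
    ∃ (k : ℕ) (q : Fin k → R), σ = ∑ j, q j ^ 2 := by
  induction h with
  | zero => exact ⟨0, Fin.elim0, by simp⟩
  | sq_add a _ ih =>
    obtain ⟨k, q, rfl⟩ := ih
    exact ⟨k + 1, Fin.cons a q, by simp [Fin.sum_univ_succ, sq]⟩

theorem isSumSq_sq {R : Type*} [CommRing R] (a : R) : IsSumSq (a ^ 2) := by
  rw [sq]
  exact IsSumSq.mul_self a

theorem mem_realRadical_iff {I : Ideal (MvPolynomial (Fin n) ℝ)} {p : MvPolynomial (Fin n) ℝ} :
    p ∈ realRadical I ↔ ∃ m, 0 < m ∧ ∃ σ, IsSumSq σ ∧ p ^ (2 * m) + σ ∈ I := by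
  constructor
  · rintro ⟨m, k, q, hm, h⟩
    exact ⟨m, hm, _, IsSumSq.sum fun j _ => isSumSq_sq (q j), h⟩
  · rintro ⟨m, hm, σ, hσ, h⟩
    obtain ⟨k, q, rfl⟩ := exists_sum_sq_of_isSumSq hσ
    exact ⟨m, k, q, hm, h⟩

/-- The condition that `-f` is a sum of squares modulo `I` passes to finite sums. -/
theorem exists_isSumSq_add_sum_mem {R ι : Type*} [CommRing R] {I : Ideal R} {s : Finset ι}
    {f : ι → R} (h : ∀ i ∈ s, ∃ σ, IsSumSq σ ∧ f i + σ ∈ I) :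
    ∃ σ, IsSumSq σ ∧ ∑ i ∈ s, f i + σ ∈ I := by
  choose! σ hσ hI using h
  refine ⟨∑ i ∈ s, σ i, IsSumSq.sum hσ, ?_⟩
  rw [← Finset.sum_add_distrib]
  exact I.sum_mem hI

theorem exists_isSumSq_mul_add_mem {R : Type*} [CommRing R] {I : Ideal R} {f τ : R}
    (h : ∃ σ, IsSumSq σ ∧ f + σ ∈ I) (hτ : IsSumSq τ) : ∃ σ, IsSumSq σ ∧ τ * f + σ ∈ I := by
  obtain ⟨σ, hσ, hI⟩ := h
  refine ⟨τ * σ, hτ.mul hσ, ?_⟩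
  rw [← mul_add]
  exact I.mul_mem_left _ hI

/-- If `-p^(2a)` and `-r^(2b)` are sums of squares modulo `I`, then so is `-(p + r)^(2(a + b))`. In
`(p + r)^(2(a + b)) + (p - r)^(2(a + b))` only even powers survive, and each surviving term is a
square multiple of `p^(2a)` or of `r^(2b)`. -/
theorem exists_isSumSq_add_pow_mem {R : Type*} [CommRing R] {I : Ideal R} {p r : R} {a b : ℕ}
    (hp : ∃ σ, IsSumSq σ ∧ p ^ (2 * a) + σ ∈ I) (hr : ∃ σ, IsSumSq σ ∧ r ^ (2 * b) + σ ∈ I) :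
    ∃ σ, IsSumSq σ ∧ (p + r) ^ (2 * (a + b)) + σ ∈ I := by
  have key : ∃ σ, IsSumSq σ ∧
      ∑ m ∈ Finset.range (2 * (a + b) + 1),
        (p ^ m * r ^ (2 * (a + b) - m) * ((2 * (a + b)).choose m : R) +
          p ^ m * (-r) ^ (2 * (a + b) - m) * ((2 * (a + b)).choose m : R)) + σ ∈ I := by
    refine exists_isSumSq_add_sum_mem fun m hm => ?_
    have hm' : m ≤ 2 * (a + b) := Nat.lt_succ_iff.1 (Finset.mem_range.1 hm)
    generalize (2 * (a + b)).choose m = c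
    obtain ⟨k, hk⟩ := Nat.exists_eq_add_of_le hm'
    have hk' : 2 * (a + b) - m = k := by lia
    rw [hk']
    rcases Nat.even_or_odd k with hke | hko
    · obtain ⟨j, hj⟩ := hke
      obtain ⟨i, hi⟩ : ∃ i, m = i + i := ⟨a + b - j, by lia⟩
      have hcsq : IsSumSq ((2 * c : ℕ) : R) := IsSumSq.natCast _
      rw [Even.neg_pow ⟨j, hj⟩]
      rcases le_total a i with hai | hia
      · obtain ⟨d, rfl⟩ := Nat.exists_eq_add_of_le hai
        have := exists_isSumSq_mul_add_mem hp
          (hcsq.mul (isSumSq_sq (p ^ d * r ^ j)))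
        convert this using 5
        rw [hi, hj]
        push_cast
        ring
      · obtain ⟨d, rfl⟩ : ∃ d, j = b + d := ⟨j - b, by lia⟩
        have := exists_isSumSq_mul_add_mem hr
          (hcsq.mul (isSumSq_sq (p ^ i * r ^ d)))
        convert this using 5
        rw [hi, hj]
        push_cast
        ring
    · refine ⟨0, IsSumSq.zero, ?_⟩
      rw [hko.neg_pow]
      simp
  rw [Finset.sum_add_distrib, ← add_pow, ← add_pow] at key
  obtain ⟨σ, hσ, h⟩ := key
  refine ⟨(p + -r) ^ (2 * (a + b)) + σ, IsSumSq.add ?_ hσ, by rwa [← add_assoc]⟩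
  rw [mul_comm, pow_mul]
  exact isSumSq_sq _

/-- The real radical, as an ideal. -/
def realRadicalIdeal (I : Ideal (MvPolynomial (Fin n) ℝ)) : Ideal (MvPolynomial (Fin n) ℝ) where
  carrier := realRadical I
  zero_mem' := mem_realRadical_iff.2 ⟨1, one_pos, 0, IsSumSq.zero, by simp⟩
  add_mem' := fun {p r} hp hr => by
    obtain ⟨a, ha, hpa⟩ := mem_realRadical_iff.1 hp
    obtain ⟨b, hb, hrb⟩ := mem_realRadical_iff.1 hr
    exact mem_realRadical_iff.2 ⟨a + b, by lia, exists_isSumSq_add_pow_mem hpa hrb⟩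
  smul_mem' := fun c p hp => by
    obtain ⟨a, ha, hpa⟩ := mem_realRadical_iff.1 hp
    refine mem_realRadical_iff.2 ⟨a, ha, ?_⟩
    rw [smul_eq_mul, mul_pow]
    refine exists_isSumSq_mul_add_mem hpa ?_
    rw [mul_comm, pow_mul]
    exact isSumSq_sq _

/-! ### Real points -/

/-- The real zeros of `I`, as points of `ℝⁿ`. -/
def realZeros (I : Ideal (MvPolynomial (Fin n) ℝ)) : Set (Fin n → ℝ) :=
  {v | ∀ p ∈ I, eval v p = 0}

theorem aeval_ofReal (v : Fin n → ℝ) (p : MvPolynomial (Fin n) ℝ) :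
    aeval (fun i => (v i : ℂ)) p = (eval v p : ℂ) :=
  aeval_algebraMap_apply ℂ v p

theorem realVariety_eq_image (I : Ideal (MvPolynomial (Fin n) ℝ)) :
    realVariety I = (fun (v : Fin n → ℝ) (i : Fin n) => (v i : ℂ)) '' realZeros I := by
  ext z
  constructor
  · rintro ⟨⟨v, rfl⟩, hz⟩
    refine ⟨v, fun p hp => ?_, rfl⟩
    have := hz p hp
    rw [aeval_ofReal] at this
    exact_mod_cast this
  · rintro ⟨v, hv, rfl⟩
    refine ⟨⟨v, rfl⟩, fun p hp => ?_⟩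
    rw [aeval_ofReal, hv p hp, Complex.ofReal_zero]

theorem ofReal_comp_injective :
    Function.Injective (fun (v : Fin n → ℝ) (i : Fin n) => (v i : ℂ)) := fun _ _ h =>
  funext fun i => Complex.ofReal_injective (congrFun h i)

theorem eval_eq_zero_of_mem_realRadical {I : Ideal (MvPolynomial (Fin n) ℝ)} {v : Fin n → ℝ}
    (hv : v ∈ realZeros I) {p : MvPolynomial (Fin n) ℝ} (hp : p ∈ realRadical I) :
    eval v p = 0 := by
  obtain ⟨m, k, q, hm, h⟩ := hp
  have h0 := hv _ h
  simp only [map_add, map_pow, map_sum] at h0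
  have h1 : 0 ≤ (eval v p) ^ (2 * m) := (even_two_mul m).pow_nonneg _
  have h2 : 0 ≤ ∑ j, (eval v (q j)) ^ 2 := Finset.sum_nonneg fun j _ => sq_nonneg _
  have : (eval v p) ^ (2 * m) = 0 := by linarith
  exact pow_eq_zero_iff (by lia) |>.1 this

theorem realZeros_subset_of_le_realRadicalIdeal {I J : Ideal (MvPolynomial (Fin n) ℝ)}
    (h : J ≤ realRadicalIdeal I) : realZeros I ⊆ realZeros J := fun _ hv _ hp =>
  eval_eq_zero_of_mem_realRadical hv (h hp)

theorem linearIndependent_eval :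
    LinearIndependent ℝ (fun (v : Fin n → ℝ) (p : MvPolynomial (Fin n) ℝ) => eval v p) := by
  have hinj : Function.Injective
      (fun v : Fin n → ℝ => (eval v : MvPolynomial (Fin n) ℝ →+* ℝ).toMonoidHom) := by
    intro v w hvw
    funext i
    have := DFunLike.congr_fun hvw (X i)
    change eval v (X i) = eval w (X i) at this
    rwa [eval_X, eval_X] at this
  exact (linearIndependent_monoidHom (MvPolynomial (Fin n) ℝ) ℝ).comp _ hinj

/-- Evaluation at a point of `ℝⁿ`, as a linear functional. -/
def evalFunctional (v : Fin n → ℝ) : Module.Dual ℝ (MvPolynomial (Fin n) ℝ) :=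
  (aeval v : MvPolynomial (Fin n) ℝ →ₐ[ℝ] ℝ).toLinearMap

theorem linearIndependent_evalFunctional :
    LinearIndependent ℝ (evalFunctional : (Fin n → ℝ) → Module.Dual ℝ (MvPolynomial (Fin n) ℝ)) :=
  LinearIndependent.of_comp (LinearMap.ltoFun ℝ (MvPolynomial (Fin n) ℝ) ℝ ℝ)
    linearIndependent_eval

theorem span_range_eq_of_card_eq_finrank {V ι : Type*} [AddCommGroup V] [Module ℝ V] [Fintype ι]
    {S : Submodule ℝ V} [FiniteDimensional ℝ S] {e : ι → V} (he : LinearIndependent ℝ e)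
    (heS : ∀ i, e i ∈ S) (hcard : Fintype.card ι = Module.finrank ℝ S) :
    Submodule.span ℝ (Set.range e) = S :=
  Submodule.eq_of_le_of_finrank_eq (Submodule.span_le.2 (Set.range_subset_iff.2 heS))
    ((finrank_span_eq_card he).trans hcard)

/-- If `J` has at least as many real zeros as the dimension of `𝓓[J]`, then the evaluations at these
zeros span `𝓓[J]`, and so `J` contains all polynomials that vanish at them. -/
theorem mem_of_forall_eval_eq_zero {J : Ideal (MvPolynomial (Fin n) ℝ)} {Z : Set (Fin n → ℝ)}
    (hZ : Z ⊆ realZeros J) [FiniteDimensional ℝ (dualSpace J)]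
    (hcard : (Module.finrank ℝ (dualSpace J) : ℕ∞) = Z.encard) {p : MvPolynomial (Fin n) ℝ}
    (hp : ∀ v ∈ Z, eval v p = 0) : p ∈ J := by
  have hfin : Z.Finite := Set.finite_of_encard_eq_coe hcard.symm
  let _ : Fintype Z := hfin.fintype
  have hli : LinearIndependent ℝ (fun v : Z => evalFunctional v.1) :=
    linearIndependent_evalFunctional.comp (fun v : Z => v.1) Subtype.val_injective
  have hc : Fintype.card Z = Module.finrank ℝ (dualSpace J) := by
    rw [← Nat.card_eq_fintype_card, Nat.card_coe_set_eq, Set.ncard, ← hcard, ENat.toNat_natCast]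
  have hspan := span_range_eq_of_card_eq_finrank (S := dualSpace J) hli
    (fun v q hq => hZ v.2 q hq) hc
  by_contra hpJ
  obtain ⟨L, hLp, hL⟩ := Submodule.exists_le_ker_of_notMem (p := J.restrictScalars ℝ) hpJ
  have hLe : L ∈ Submodule.span ℝ (Set.range fun v : Z => evalFunctional v.1) := by
    rw [hspan]
    exact fun q hq => hL hq
  have hall : ∀ M ∈ Submodule.span ℝ (Set.range fun v : Z => evalFunctional v.1), M p = 0 := by
    intro M hM
    induction hM using Submodule.span_induction with
    | mem x hx =>
      obtain ⟨v, rfl⟩ := hx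
      exact hp v.1 v.2
    | zero => rfl
    | add x y _ _ ihx ihy => rw [LinearMap.add_apply, ihx, ihy, add_zero]
    | smul c x _ ih => rw [LinearMap.smul_apply, ih, smul_zero]
  exact hLp (hall _ hLe)

/-! ### The ideal generated by the border polynomials -/

section Border

variable {s : ℕ} {B G : Set (MvPolynomial (Fin n) ℝ)}

theorem border_subset_polyLE (hs : 1 ≤ s) (hB : B ⊆ monomialsLE n (s - 1)) :
    border B ⊆ (PolyLE n s : Set (MvPolynomial (Fin n) ℝ)) := by
  have h := prolongation_subset_polyLE (hB.trans (monomialsLE_subset_polyLE n (s - 1)))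
  rw [Nat.sub_add_cancel hs] at h
  exact Set.sdiff_subset.trans h

theorem phi_mem_span (hdec : Decomposition s B G) (p : PolyLE n s) :
    (phi hdec p : MvPolynomial (Fin n) ℝ) ∈ Submodule.span ℝ B :=
  Submodule.projection_apply_mem (p := spanIn s B) hdec p

theorem sub_phi_mem_span (hdec : Decomposition s B G) (p : PolyLE n s) :
    (p - phi hdec p : MvPolynomial (Fin n) ℝ) ∈ Submodule.span ℝ G := by
  have h := Submodule.projection_apply_mem (p := spanIn s G) hdec.symm p
  rw [Submodule.projection_eq_self_sub_projection] at h
  exact h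

theorem phi_eq_zero (hdec : Decomposition s B G) {p : PolyLE n s}
    (hp : (p : MvPolynomial (Fin n) ℝ) ∈ Submodule.span ℝ G) : phi hdec p = 0 :=
  (Submodule.projection_apply_eq_zero_iff (p := spanIn s B) hdec).2 hp

theorem span_borderPolys_le (hdec : Decomposition s B G) {A : Ideal (MvPolynomial (Fin n) ℝ)}
    (hA : ∀ p ∈ PolyLE n s, p ∈ Submodule.span ℝ G → p ∈ A) :
    Ideal.span (borderPolys hdec) ≤ A := by
  rw [Ideal.span_le]
  rintro _ ⟨m, -, rfl⟩
  exact hA _ (m - phi hdec m).2 (sub_phi_mem_span hdec m)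

/-- Rewriting by the border polynomials reduces every polynomial to one in the span of `B`. -/
theorem exists_sub_mem_span_borderPolys (hs : 1 ≤ s) (hB : B ⊆ monomialsLE n (s - 1))
    (h1 : (1 : MvPolynomial (Fin n) ℝ) ∈ B) (hdec : Decomposition s B G)
    (p : MvPolynomial (Fin n) ℝ) :
    ∃ b ∈ Submodule.span ℝ B, p - b ∈ Ideal.span (borderPolys hdec) := by
  set J := Ideal.span (borderPolys hdec) with hJ
  have hX : ∀ i : Fin n, ∀ b ∈ Submodule.span ℝ B,
      X i * b ∈ Submodule.span ℝ B ⊔ J.restrictScalars ℝ := by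
    intro i b hb
    induction hb using Submodule.span_induction with
    | mem m hm =>
      by_cases hmem : X i * m ∈ B
      · exact Submodule.mem_sup_left (Submodule.subset_span hmem)
      · have hbd : X i * m ∈ border B := ⟨Or.inr (Set.mem_iUnion.2 ⟨i, m, hm, rfl⟩), hmem⟩
        let q : PolyLE n s := ⟨X i * m, border_subset_polyLE hs hB hbd⟩
        have hq : ((q - phi hdec q : PolyLE n s) : MvPolynomial (Fin n) ℝ) ∈ J :=
          Ideal.subset_span ⟨q, hbd, rfl⟩
        exact Submodule.mem_sup.2 ⟨_, phi_mem_span hdec q, _, hq, add_sub_cancel _ _⟩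
    | zero => simp
    | add x y _ _ ihx ihy => rw [mul_add]; exact add_mem ihx ihy
    | smul c x _ ih => rw [mul_smul_comm]; exact Submodule.smul_mem _ _ ih
  have hmem : p ∈ Submodule.span ℝ B ⊔ J.restrictScalars ℝ := by
    induction p using MvPolynomial.induction_on with
    | C a =>
      rw [C_eq_smul_one]
      exact Submodule.mem_sup_left (Submodule.smul_mem _ _ (Submodule.subset_span h1))
    | add p q hp hq => exact add_mem hp hq
    | mul_X p i ih =>
      obtain ⟨b, hb, j, hj, rfl⟩ := Submodule.mem_sup.1 ih
      rw [mul_comm, mul_add]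
      exact add_mem (hX i b hb) (Submodule.mem_sup_right (J.mul_mem_left _ hj))
  obtain ⟨b, hb, j, hj, rfl⟩ := Submodule.mem_sup.1 hmem
  exact ⟨b, hb, by simpa using hj⟩

theorem isRewritingFamily_borderPolys (hs : 1 ≤ s) (hB : B ⊆ monomialsLE n (s - 1))
    (hdec : Decomposition s B G) : IsRewritingFamily B (borderPolys hdec) := by
  classical
  have hbd : ∀ m ∈ border B, m ∈ PolyLE n s := fun m hm => border_subset_polyLE hs hB hm
  refine ⟨fun m => if hm : m ∈ PolyLE n s then (phi hdec ⟨m, hm⟩ : MvPolynomial (Fin n) ℝ) else 0,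
    fun m hm => ?_, ?_⟩
  · simp only [dif_pos (hbd m hm)]
    exact phi_mem_span hdec _
  · ext f
    constructor
    · rintro ⟨m, hm, rfl⟩
      refine ⟨m, hm, ?_⟩
      simp only [dif_pos m.2]
      rfl
    · rintro ⟨m, hm, rfl⟩
      refine ⟨⟨m, hbd m hm⟩, hm, ?_⟩
      simp only [dif_pos (hbd m hm)]
      rfl

theorem linearIndepOn_monomials (hB : B ⊆ monomials n) : LinearIndepOn ℝ id B := by
  have hr : monomials n = Set.range (basisMonomials (Fin n) ℝ) := by
    ext m
    simp [monomials, eq_comm]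
  rw [hr] at hB
  exact (basisMonomials (Fin n) ℝ).linearIndependent.linearIndepOn_id.mono hB

theorem isBasisMod_of_forall {J : Ideal (MvPolynomial (Fin n) ℝ)} (hB : B ⊆ monomials n)
    (hindep : ∀ b ∈ Submodule.span ℝ B, b ∈ J → b = 0)
    (hspan : ∀ p, ∃ b ∈ Submodule.span ℝ B, p - b ∈ J) : IsBasisMod B J := by
  let q : MvPolynomial (Fin n) ℝ →ₗ[ℝ] MvPolynomial (Fin n) ℝ ⧸ J :=
    (Ideal.Quotient.mkₐ ℝ J).toLinearMap
  have hq : ∀ p, q p = Ideal.Quotient.mk J p := fun p => rfl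
  constructor
  · have hli : LinearIndependent ℝ (fun b : B => (b : MvPolynomial (Fin n) ℝ)) :=
      linearIndepOn_monomials hB
    refine hli.map (f := q) ?_
    rw [Subtype.range_coe, Submodule.disjoint_def]
    intro b hb hbq
    refine hindep b hb (Ideal.Quotient.eq_zero_iff_mem.1 ?_)
    rwa [← hq]
  · rw [eq_top_iff]
    intro x _
    obtain ⟨p, rfl⟩ := Ideal.Quotient.mk_surjective x
    obtain ⟨b, hb, hpb⟩ := hspan p
    rw [Ideal.Quotient.eq.2 hpb, ← hq]
    have : Submodule.span ℝ (Set.range fun b : B => Ideal.Quotient.mk J b.1) =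
        (Submodule.span ℝ B).map q := by
      rw [Submodule.map_span, Set.image_eq_range]
      rfl
    rw [this]
    exact Submodule.mem_map_of_mem hb

/-- The span of `G` agrees in degree at most `s` with an ideal: flat extension, with the
projection `φ` serving to reduce degrees. -/
theorem exists_ideal_of_decomposition (hs : 1 ≤ s) (hB : B ⊆ monomialsLE n (s - 1))
    (hflat : ∀ p ∈ PolyLE n s, p ∈ Submodule.span ℝ (prolongation G) → p ∈ Submodule.span ℝ G)
    (hdec : Decomposition s B G) :
    ∃ A : Ideal (MvPolynomial (Fin n) ℝ), ∀ p ∈ PolyLE n s, p ∈ A ↔ p ∈ Submodule.span ℝ G := by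
  have hspanB : Submodule.span ℝ B ≤ PolyLE n (s - 1) :=
    Submodule.span_le.2 (hB.trans (monomialsLE_subset_polyLE n (s - 1)))
  -- the flat extension argument uses `φ` on all of `ℝ[x]`; its values in higher degree are
  -- irrelevant as long as they stay in the span of `B`
  obtain ⟨Ψ, hΨ⟩ := LinearMap.exists_extend (LinearMap.codRestrict (Submodule.span ℝ B)
    ((PolyLE n s).subtype ∘ₗ phi hdec) (phi_mem_span hdec))
  have hΨ' : ∀ p (hp : p ∈ PolyLE n s),
      (Ψ p : MvPolynomial (Fin n) ℝ) = phi hdec ⟨p, hp⟩ := fun p hp =>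
    congrArg Subtype.val (LinearMap.congr_fun hΨ ⟨p, hp⟩)
  refine exists_ideal_of_flat hs (fun i p hp => X_mul_mem_span_prolongation G i hp) hflat
    ((Submodule.span ℝ B).subtype ∘ₗ Ψ) (fun p => hspanB (Ψ p).2) (fun p hp => ?_)
    (fun p hp hpK => ?_)
  · rw [LinearMap.comp_apply, Submodule.subtype_apply, hΨ' p hp]
    exact sub_phi_mem_span hdec ⟨p, hp⟩
  · rw [LinearMap.comp_apply, Submodule.subtype_apply, hΨ' p hp, phi_eq_zero hdec hpK]
    rfl

theorem eq_zero_of_mem_span_of_mem_span (hB : B ⊆ monomialsLE n (s - 1))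
    (hdec : Decomposition s B G) {b : MvPolynomial (Fin n) ℝ} (hb : b ∈ Submodule.span ℝ B)
    (hbG : b ∈ Submodule.span ℝ G) : b = 0 := by
  have hbs : b ∈ PolyLE n s := polyLE_mono (Nat.sub_le s 1)
    (Submodule.span_le.2 (hB.trans (monomialsLE_subset_polyLE n (s - 1))) hb)
  have := Submodule.disjoint_def.1 hdec.disjoint ⟨b, hbs⟩ hb hbG
  exact congrArg Subtype.val this

/-- The ideal of the border polynomials meets the span of `B` trivially and agrees with the span of
`G` in degree at most `s`. -/
theorem span_borderPolys_disjoint_and_truncation (hs : 1 ≤ s) (hB : B ⊆ monomialsLE n (s - 1))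
    (h1 : (1 : MvPolynomial (Fin n) ℝ) ∈ B)
    (hflat : ∀ p ∈ PolyLE n s, p ∈ Submodule.span ℝ (prolongation G) → p ∈ Submodule.span ℝ G)
    (hdec : Decomposition s B G) :
    (∀ b ∈ Submodule.span ℝ B, b ∈ Ideal.span (borderPolys hdec) → b = 0) ∧
    ∀ p ∈ PolyLE n s, p ∈ Ideal.span (borderPolys hdec) ↔ p ∈ Submodule.span ℝ G := by
  have hspanB : Submodule.span ℝ B ≤ PolyLE n s :=
    (Submodule.span_le.2 (hB.trans (monomialsLE_subset_polyLE n (s - 1)))).trans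
      (polyLE_mono (Nat.sub_le s 1))
  obtain ⟨A, hA⟩ := exists_ideal_of_decomposition hs hB hflat hdec
  have hJA : Ideal.span (borderPolys hdec) ≤ A :=
    span_borderPolys_le hdec fun p hp => (hA p hp).2
  have hindep : ∀ b ∈ Submodule.span ℝ B, b ∈ A → b = 0 := fun b hb hbA =>
    eq_zero_of_mem_span_of_mem_span hB hdec hb ((hA b (hspanB hb)).1 hbA)
  refine ⟨fun b hb hbJ => hindep b hb (hJA hbJ), fun p hp => ⟨fun h => (hA p hp).1 (hJA h),
    fun h => ?_⟩⟩
  obtain ⟨b, hb, hpb⟩ := exists_sub_mem_span_borderPolys hs hB h1 hdec p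
  have hbA : b ∈ A := by
    have := sub_mem ((hA p hp).2 h) (hJA hpb)
    rwa [sub_sub_cancel] at this
  rwa [hindep b hb hbA, sub_zero] at hpb

end Border

/-! ### Dimension of the dual of the quotient -/

theorem projFull_domRestrict_injective {s : ℕ} {J : Ideal (MvPolynomial (Fin n) ℝ)}
    (hred : ∀ p, ∃ b ∈ PolyLE n s, p - b ∈ J) :
    Function.Injective ((projFull n s).domRestrict (dualSpace J)) := by
  rintro ⟨L, hL⟩ ⟨L', hL'⟩ h
  refine Subtype.ext (LinearMap.ext fun p => ?_)
  obtain ⟨b, hb, hpb⟩ := hred p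
  have h1 : L b = L' b := LinearMap.congr_fun h ⟨b, hb⟩
  have h2 : L (p - b) = 0 := hL _ hpb
  have h3 : L' (p - b) = 0 := hL' _ hpb
  rw [map_sub, sub_eq_zero] at h2 h3
  rw [h2, h3, h1]

theorem finiteDimensional_dualSpace {s : ℕ} {J : Ideal (MvPolynomial (Fin n) ℝ)}
    (hred : ∀ p, ∃ b ∈ PolyLE n s, p - b ∈ J) : FiniteDimensional ℝ (dualSpace J) :=
  FiniteDimensional.of_injective _ (projFull_domRestrict_injective hred)

theorem finrank_dualSpace {s : ℕ} {J : Ideal (MvPolynomial (Fin n) ℝ)}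
    (hred : ∀ p, ∃ b ∈ PolyLE n s, p - b ∈ J) :
    Module.finrank ℝ (dualSpace J) = Module.finrank ℝ ((dualSpace J).map (projFull n s)) := by
  rw [← LinearMap.finrank_range_of_inj (projFull_domRestrict_injective hred),
    LinearMap.range_domRestrict]

theorem map_projFull_dualSpace_eq {s t : ℕ} (hst : s ≤ t) {G : Set (MvPolynomial (Fin n) ℝ)}
    (hG : G ⊆ (PolyLE n t : Set (MvPolynomial (Fin n) ℝ))) {J : Ideal (MvPolynomial (Fin n) ℝ)}
    (hJ : ∀ p ∈ PolyLE n s, p ∈ J ↔ p ∈ Submodule.span ℝ G) :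
    (dualSpace J).map (projFull n s) = (perp t G).map (proj n hst) := by
  rw [map_perp hst hG, map_dualSpace]
  ext L
  simp only [range_dualMap_truncQuot, Submodule.restrictScalars_mem]
  exact forall_congr' fun p => by rw [hJ p p.2]

end ProlongProj

end

open ProlongProj in
theorem theorem3p1 (n r s t : ℕ) (hs : 1 ≤ s) (hst : s ≤ t)
    (h : Fin r → MvPolynomial (Fin n) ℝ)
    (I : Ideal (MvPolynomial (Fin n) ℝ)) (hI : I = Ideal.span (Set.range h))
    (G : Set (MvPolynomial (Fin n) ℝ))
    (hGt : G ⊆ (PolyLE n t : Set (MvPolynomial (Fin n) ℝ)))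
    (hhG : ∀ j, h j ∈ G) :
    (G ⊆ (I : Set (MvPolynomial (Fin n) ℝ)) →
      Module.finrank ℝ ((perp t G).map (proj n hst)) = 0 → complexVariety I = ∅) ∧
    (G ⊆ realRadical I →
      Module.finrank ℝ ((perp t G).map (proj n hst)) = 0 → realVariety I = ∅) ∧
    ((G ⊆ (I : Set (MvPolynomial (Fin n) ℝ)) ∨ G ⊆ realRadical I) →
      (Finset.univ.sup fun j => (h j).totalDegree) ≤ s →
      Module.finrank ℝ ((perp t G).map (proj n hst)) =
        Module.finrank ℝ ((perp t G).map (proj n ((Nat.sub_le s 1).trans hst))) →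
      Module.finrank ℝ ((perp t G).map (proj n hst)) =
        Module.finrank ℝ
          ((perp (t + 1) (prolongation G)).map (proj n (hst.trans (Nat.le_succ t)))) →
      (∃ B ⊆ monomialsLE n (s - 1),
        DivisionClosed B ∧ ConnectedToOne B ∧ Decomposition s B G) ∧
      (Module.finrank ℝ ((perp t G).map (proj n hst)) ≠ 0 →
        ∀ B ⊆ monomialsLE n (s - 1), ConnectedToOne B → ∀ hB : Decomposition s B G,
        ∀ J : Ideal (MvPolynomial (Fin n) ℝ), J = Ideal.span (borderPolys hB) →
          IsBasisMod B J ∧ IsBorderBasis B (borderPolys hB) J ∧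
          (G ⊆ (I : Set (MvPolynomial (Fin n) ℝ)) → J = I) ∧
          (G ⊆ realRadical I →
            realVariety I = complexVariety J ∩ realPoints n ∧
            J.restrictScalars ℝ ⊓ PolyLE n s = Submodule.span ℝ G ⊓ PolyLE n s ∧
            (dualSpace J).map (projFull n s) = (perp t G).map (proj n hst) ∧
            ((Module.finrank ℝ ((perp t G).map (proj n hst)) : ℕ∞) = (realVariety I).encard →
              (J : Set (MvPolynomial (Fin n) ℝ)) = realRadical I)))) := by
  have hspanI : G ⊆ (I : Set (MvPolynomial (Fin n) ℝ)) →
      ∀ p ∈ Submodule.span ℝ G, p ∈ I := fun hG p hp =>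
    (Submodule.span_le (p := I.restrictScalars ℝ)).2 hG hp
  have hspanR : G ⊆ realRadical I → ∀ p ∈ Submodule.span ℝ G, p ∈ realRadicalIdeal I :=
    fun hG p hp => (Submodule.span_le (p := (realRadicalIdeal I).restrictScalars ℝ)).2 hG hp
  have hone : (1 : MvPolynomial (Fin n) ℝ) ∈ PolyLE n s := mem_polyLE.2 (by simp)
  refine ⟨fun hG h0 => ?_, fun hG h0 => ?_, fun _ hD hdim1 hdim2 => ?_⟩
  · rw [finrank_map_perp hst hGt] at h0
    have h1 := hspanI hG 1 (mem_of_finrank_truncQuot_eq_zero h0 hone)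
    rw [complexVariety, (Ideal.eq_top_iff_one I).2 h1, zeroLocus_top]
    rfl
  · rw [finrank_map_perp hst hGt] at h0
    have h1 := hspanR hG 1 (mem_of_finrank_truncQuot_eq_zero h0 hone)
    rw [realVariety_eq_image, Set.image_eq_empty, Set.eq_empty_iff_forall_notMem]
    intro v hv
    have := eval_eq_zero_of_mem_realRadical hv h1
    rw [map_one] at this
    exact one_ne_zero this
  · have hflat : ∀ p ∈ PolyLE n s, p ∈ Submodule.span ℝ (prolongation G) →
        p ∈ Submodule.span ℝ G := fun p hp hpG => by
      rw [finrank_map_perp hst hGt, finrank_map_perp _ (prolongation_subset_polyLE hGt)] at hdim2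
      exact mem_of_finrank_truncQuot_eq (span_le_span_prolongation G) hdim2 hp hpG
    have hred : ∀ p ∈ PolyLE n s, ∃ q ∈ PolyLE n (s - 1), p - q ∈ Submodule.span ℝ G :=
      fun p hp => by
        rw [finrank_map_perp hst hGt, finrank_map_perp _ hGt] at hdim1
        exact exists_sub_mem_of_finrank_truncQuot_eq (Nat.sub_le s 1) hdim1 hp
    refine ⟨?_, ?_⟩
    · have hsub := standardMonomials_subset_monomialsLE hred
      have hdiv := standardMonomials_divisionClosed
        (fun i p hp => X_mul_mem_span_prolongation G i hp) hflat
      exact ⟨_, hsub, hdiv, hdiv.connectedToOne (hsub.trans (monomialsLE_subset_monomials n _)),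
        decomposition_standardMonomials⟩
    · rintro hne B hB hconn hdec J rfl
      have hBmon := hB.trans (monomialsLE_subset_monomials n _)
      -- if `B` were empty, all polynomials of degree at most `s` would lie in the span of `G`
      have hBne : B.Nonempty := by
        rw [Set.nonempty_iff_ne_empty]
        rintro rfl
        refine hne ?_
        rw [finrank_map_perp hst hGt, Submodule.finrank_eq_zero, LinearMap.range_eq_bot]
        ext1 p
        have hmem := sub_phi_mem_span hdec p
        have hphi := phi_mem_span hdec p
        rw [Submodule.span_empty, Submodule.mem_bot] at hphi
        rw [hphi, sub_zero] at hmem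
        exact mem_ker_truncQuot.2 hmem
      have h1 := hconn.one_mem hBne
      obtain ⟨hindep, hJs⟩ := span_borderPolys_disjoint_and_truncation hs hB h1 hflat hdec
      have hspan := exists_sub_mem_span_borderPolys hs hB h1 hdec
      have hbasis := isBasisMod_of_forall hBmon hindep hspan
      have hIJ : I ≤ Ideal.span (borderPolys hdec) := by
        rw [hI, Ideal.span_le]
        rintro _ ⟨j, rfl⟩
        have hj : (h j).totalDegree ≤ s :=
          (Finset.le_sup (f := fun j => (h j).totalDegree) (Finset.mem_univ j)).trans hD
        exact (hJs _ (mem_polyLE.2 hj)).2 (Submodule.subset_span (hhG j))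
      refine ⟨hbasis, ⟨hBmon, h1, isRewritingFamily_borderPolys hs hB hdec, hbasis, rfl⟩,
        fun hG => le_antisymm (span_borderPolys_le hdec fun p _ hp => hspanI hG p hp) hIJ,
        fun hG => ?_⟩
      have hJR : Ideal.span (borderPolys hdec) ≤ realRadicalIdeal I :=
        span_borderPolys_le hdec fun p _ hp => hspanR hG p hp
      have hzeros := realZeros_subset_of_le_realRadicalIdeal hJR
      have hD := map_projFull_dualSpace_eq hst hGt hJs
      refine ⟨?_, ?_, hD, fun hcard => ?_⟩
      · rw [Set.inter_comm]
        change _ = realVariety _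
        refine Set.Subset.antisymm ?_ (Set.inter_subset_inter_right _ (zeroLocus_anti_mono hIJ))
        rw [realVariety_eq_image, realVariety_eq_image]
        exact Set.image_mono hzeros
      · ext p
        simp only [Submodule.mem_inf, Submodule.restrictScalars_mem]
        exact and_congr_left fun hp => hJs p hp
      · have hreds : ∀ p, ∃ b ∈ PolyLE n s, p - b ∈ Ideal.span (borderPolys hdec) := fun p => by
          obtain ⟨b, hb, hpb⟩ := hspan p
          exact ⟨b, polyLE_mono (Nat.sub_le s 1) (Submodule.span_le.2
            (hB.trans (monomialsLE_subset_polyLE n (s - 1))) hb), hpb⟩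
        have := finiteDimensional_dualSpace hreds
        refine Set.Subset.antisymm hJR fun p hp => ?_
        refine mem_of_forall_eval_eq_zero hzeros ?_ fun v hv =>
          eval_eq_zero_of_mem_realRadical hv hp
        rw [finrank_dualSpace hreds, hD, hcard, realVariety_eq_image,
          ofReal_comp_injective.encard_image]
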